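/- Let $K$ be a global field (a number field, or a finite extension of the rational function field $\mathbb{F}_q(t)$ over a finite field $\mathbb{F}_q$), let $r\ge 1$, and let $a_1,\dots,a_r\in K$ (not necessarily distinct). The following three conditions are equivalent. 1. There exist a finite Galois extension $L/K$ and nonzero elements $\theta_1,\dots,\theta_r\in L$, any two of which are conjugate under $\mathrm{Gal}(L/K)$ (repetitions allowed), such that $\sum_{i=1}^r a_i\theta_i=0$. 2. There exists a probability distribution $(X_1,\dots,X_r)$ on $K^r$, different from the point mass at the origin, which is supported on a finite subset of the hyperplane $\{x\in K^r:\sum_{i=1}^r a_ix_i=0\}$ and whose marginals $X_1,\dots,X_r$ are all equal in distribution. 3. There exist an integer $N\ge 1$ and $N\times N$ permutation matrices $\Pi_1,\dots,\Pi_r$ (repetitions allowed) such that $\det\left(\sum_{i=1}^r a_i\Pi_i\right)=0$. -/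

import Mathlib

/-- A global field: a number field, or a finite extension of the rational function field
`F(t)` over some finite field `F`. -/
def IsGlobalField (K : Type*) [Field K] : Prop :=
  NumberField K ∨
    ∃ (F : Type) (_ : Field F) (_ : Finite F) (_ : Algebra (RatFunc F) K), FunctionField F K

/-- Some finite Galois extension `L` of `K` contains nonzero elements `θ 0, …, θ (r - 1)`, any two
of which are conjugate under `Gal(L/K)`, with `∑ i, a i * θ i = 0`. -/
def HasGaloisConjugateRelation.{u} {K : Type u} [Field K] {r : ℕ} (a : Fin r → K) : Prop :=
  ∃ (L : Type u) (_ : Field L) (_ : Algebra K L), FiniteDimensional K L ∧ IsGalois K L ∧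
    ∃ θ : Fin r → L,
      (∀ i, θ i ≠ 0) ∧
      (∀ i j, ∃ σ : L ≃ₐ[K] L, σ (θ i) = θ j) ∧
      ∑ i, algebraMap K L (a i) * θ i = 0

/-- There is a probability distribution on `K ^ r`, other than the point mass at the origin,
supported on a finite subset of the hyperplane `∑ i, a i * x i = 0`, whose one-dimensional
marginals are all equal. -/
def HasBalancedDistribution {K : Type*} [Field K] {r : ℕ} (a : Fin r → K) : Prop :=
  ∃ X : PMF (Fin r → K),
    X ≠ PMF.pure 0 ∧
    X.support.Finite ∧
    X.support ⊆ {x | ∑ i, a i * x i = 0} ∧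
    ∀ i j, X.map (fun x => x i) = X.map (fun x => x j)

/-- For some `N` there are permutation matrices `Π 0, …, Π (r - 1)` of size `N` with
`det (∑ i, a i • Π i) = 0`. (For `N = 0` the determinant is `1`, so `N` is positive.) -/
def HasSingularPermutationCombination {K : Type*} [Field K] {r : ℕ} (a : Fin r → K) : Prop :=
  ∃ (N : ℕ) (P : Fin r → Equiv.Perm (Fin N)),
    (∑ i, a i • (P i).permMatrix K).det = 0

/-! Everything passes through condition 3, read as a nonzero `v` with `∑ i, a i * v (P i n) = 0` for
all `n`. A Galois relation gives such a vector on the Galois group, and a uniform random `n` turns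
`v` into a distribution. Conversely, a distribution is made rational (`exists_linearMap_rat_pos`),
its atoms are replaced by multiple copies, and equal marginals supply the permutations. For 3 → 1,
the permutations are realised in a Galois group `S_ℓ`, `ℓ ≥ N` prime, `v` is pulled back to the
group, and a normal basis converts it to an element of `L`. The `S_ℓ`-extension comes from a
polynomial irreducible modulo one prime (so `ℓ` divides the group order) and, modulo another, a
quadratic times an irreducible of odd degree `ℓ - 2` (so a power of Frobenius is a transposition).
-/

theorem HasSingularPermutationCombination.of_ker {K L α : Type*} [Field K] [Field L] [Algebra K L]
    [Fintype α] {r : ℕ} {a : Fin r → K} (P : Fin r → Equiv.Perm α) (v : α → L) (hv : v ≠ 0)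
    (h : ∀ x, ∑ i, algebraMap K L (a i) * v (P i x) = 0) :
    HasSingularPermutationCombination a := by
  classical
  let e := Fintype.equivFin α
  refine ⟨Fintype.card α, fun i => e.permCongr (P i), ?_⟩
  -- The determinant lies in `K`, so its vanishing may be tested over `L`.
  apply (algebraMap K L).injective
  rw [RingHom.map_det, map_zero, ← Matrix.exists_mulVec_eq_zero_iff]
  refine ⟨v ∘ e.symm, fun h0 => hv ?_, ?_⟩
  · ext x
    simpa using congrFun h0 (e x)
  · have hM : (algebraMap K L).mapMatrix (∑ i, a i • (e.permCongr (P i)).permMatrix K) =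
        ∑ i, algebraMap K L (a i) • (e.permCongr (P i)).permMatrix L := by
      rw [map_sum]
      refine Finset.sum_congr rfl fun i _ => ?_
      ext x y
      simp [Equiv.Perm.permMatrix, PEquiv.toMatrix_apply, apply_ite (algebraMap K L)]
    rw [hM, Matrix.sum_mulVec]
    ext n
    simp only [Matrix.smul_mulVec, Matrix.permMatrix_mulVec, Finset.sum_apply, Pi.smul_apply,
      smul_eq_mul, Function.comp_apply, Equiv.permCongr_apply, Equiv.symm_apply_apply,
      Pi.zero_apply]
    exact h _

theorem HasSingularPermutationCombination.exists_ker {K : Type*} [Field K] {r : ℕ} {a : Fin r → K}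
    (h : HasSingularPermutationCombination a) :
    ∃ (N : ℕ) (P : Fin r → Equiv.Perm (Fin N)) (v : Fin N → K), v ≠ 0 ∧
      ∀ n, ∑ i, a i * v (P i n) = 0 := by
  obtain ⟨N, P, h⟩ := h
  obtain ⟨v, hv, h⟩ := Matrix.exists_mulVec_eq_zero_iff.mpr h
  refine ⟨N, P, v, hv, fun n => ?_⟩
  have := congrFun h n
  rw [Matrix.sum_mulVec] at this
  simpa [Matrix.smul_mulVec, Matrix.permMatrix_mulVec, Finset.sum_apply] using this

theorem HasGaloisConjugateRelation.hasSingularPermutationCombination {K : Type*} [Field K] {r : ℕ}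
    (hr : 1 ≤ r) {a : Fin r → K} (h : HasGaloisConjugateRelation a) :
    HasSingularPermutationCombination a := by
  obtain ⟨L, _, _, _, _, θ, h0, hconj, hsum⟩ := h
  choose σ hσ using fun i => hconj ⟨0, hr⟩ i
  -- Row `g` of the kernel equation is `g` applied to the given relation.
  refine .of_ker (fun i => Equiv.mulRight (σ i)) (fun g : Gal(L/K) => g (θ ⟨0, hr⟩))
    (fun h => h0 ⟨0, hr⟩ (by simpa using congrFun h 1)) fun g => ?_
  have := congrArg g hsum
  simpa [hσ] using this

theorem HasSingularPermutationCombination.hasBalancedDistribution {K : Type*} [Field K] {r : ℕ}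
    (hr : 1 ≤ r) {a : Fin r → K} (h : HasSingularPermutationCombination a) :
    HasBalancedDistribution a := by
  obtain ⟨N, P, v, hv, h⟩ := h.exists_ker
  obtain ⟨n₀, hn₀⟩ := Function.ne_iff.mp hv
  have : Nonempty (Fin N) := ⟨n₀⟩
  have hX : ∀ i, ((PMF.uniformOfFintype (Fin N)).map fun n i => v (P i n)).map (fun x => x i) =
      (PMF.uniformOfFintype (Fin N)).map v := by
    intro i
    have hu : (PMF.uniformOfFintype (Fin N)).map (P i) = PMF.uniformOfFintype (Fin N) := by
      ext n
      simp only [PMF.map_apply, PMF.uniformOfFintype_apply]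
      rw [tsum_eq_single ((P i).symm n)]
      · simp
      · intro m hm
        rw [if_neg]
        rintro rfl
        simp at hm
    rw [PMF.map_comp]
    conv_rhs => rw [← hu, PMF.map_comp]
    rfl
  refine ⟨(PMF.uniformOfFintype (Fin N)).map fun n i => v (P i n), fun h0 => ?_, ?_, ?_, ?_⟩
  · have h1 := hX ⟨0, hr⟩
    rw [h0, PMF.pure_map] at h1
    have h2 : v n₀ ∈ ((PMF.uniformOfFintype (Fin N)).map v).support :=
      (PMF.mem_support_map_iff _ _ _).mpr ⟨n₀, by simp, rfl⟩
    rw [← h1] at h2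
    exact hn₀ (by simpa using h2)
  · rw [PMF.support_map]
    exact Set.toFinite _
  · rw [PMF.support_map]
    rintro _ ⟨n, -, rfl⟩
    exact h n
  · intro i j
    rw [hX, hX]

/-! ### From real weights to permutations -/

/-- On the `ℚ`-span of the weights, the inclusion into `ℝ` is positive at each weight. This is an
open condition on the images of a basis, so nearby rational images also satisfy it. -/
theorem exists_linearMap_rat_pos {ι : Type*} [Finite ι] (w : ι → ℝ) (hw : ∀ i, 0 < w i) :
    ∃ φ : ℝ →ₗ[ℚ] ℚ, ∀ i, 0 < φ (w i) := by
  let V := Submodule.span ℚ (Set.range w)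
  have : FiniteDimensional ℚ V := FiniteDimensional.span_of_finite ℚ (Set.finite_range w)
  let b := Module.finBasis ℚ V
  let w' : ι → V := fun i => ⟨w i, Submodule.subset_span ⟨i, rfl⟩⟩
  have hopen : IsOpen {y : Fin (Module.finrank ℚ V) → ℝ |
      ∀ i, 0 < ∑ j, (b.repr (w' i) j : ℝ) * y j} := by
    rw [Set.ofPred_forall]
    exact isOpen_iInter_of_finite fun i => isOpen_lt continuous_const (by fun_prop)
  have hmem : (fun j => ((b j : V) : ℝ)) ∈ {y : Fin (Module.finrank ℚ V) → ℝ |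
      ∀ i, 0 < ∑ j, (b.repr (w' i) j : ℝ) * y j} := by
    intro i
    have h1 := congrArg (Subtype.val) (b.sum_repr (w' i))
    simp only [Submodule.coe_sum, Submodule.coe_smul, Rat.smul_def] at h1
    rw [h1]
    exact hw i
  obtain ⟨q, hq⟩ := (DenseRange.piMap fun _ : Fin (Module.finrank ℚ V) =>
    Rat.denseRange_cast (𝕜 := ℝ)).exists_mem_open hopen ⟨_, hmem⟩
  obtain ⟨φ, hφ⟩ := (b.constr ℚ q).exists_extend
  refine ⟨φ, fun i => ?_⟩
  have h1 : φ (w i) = b.constr ℚ q (w' i) := by rw [← hφ]; rfl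
  rw [h1, Module.Basis.constr_apply_fintype]
  have := hq i
  simp only [Pi.map_apply] at this
  simp only [Module.Basis.equivFun_apply, smul_eq_mul]
  exact_mod_cast this

theorem exists_nat_common_denominator {ι : Type*} [Fintype ι] (q : ι → ℚ) (hq : ∀ i, 0 < q i) :
    ∃ (D : ℚ) (m : ι → ℕ), (∀ i, 0 < m i) ∧ ∀ i, (m i : ℚ) = D * q i := by
  have key : ∀ i, ∃ m : ℕ, (m : ℚ) = ((∏ j, (q j).den : ℕ) : ℚ) * q i := by
    intro i
    obtain ⟨k, hk⟩ := Finset.dvd_prod_of_mem (fun j => (q j).den) (Finset.mem_univ i)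
    refine ⟨k * (q i).num.toNat, ?_⟩
    have hn : (((q i).num.toNat : ℤ) : ℚ) = (q i).num := by
      rw [Int.toNat_of_nonneg (Rat.num_nonneg.mpr (hq i).le)]
    have hd := Rat.mul_den_eq_num (q i)
    rw [hk]
    push_cast at hn ⊢
    rw [hn, ← hd]
    ring
  choose m hm using key
  refine ⟨_, m, fun i => ?_, hm⟩
  have h1 : (0 : ℚ) < m i := by
    rw [hm]
    refine mul_pos ?_ (hq i)
    exact_mod_cast Finset.prod_pos fun j _ => (q j).den_pos
  exact_mod_cast h1

theorem HasBalancedDistribution.hasSingularPermutationCombination {K : Type*} [Field K] {r : ℕ}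
    (hr : 1 ≤ r) {a : Fin r → K} (h : HasBalancedDistribution a) :
    HasSingularPermutationCombination a := by
  classical
  obtain ⟨X, hX0, hfin, hsub, hmarg⟩ := h
  have : Fintype X.support := hfin.fintype
  have hw : ∀ x : X.support, 0 < (X x).toReal := fun x =>
    ENNReal.toReal_pos x.2 (X.apply_ne_top _)
  obtain ⟨φ, hφ⟩ := exists_linearMap_rat_pos (fun x : X.support => (X x).toReal) hw
  obtain ⟨D, m, hm0, hm⟩ := exists_nat_common_denominator _ hφ
  have hmap : ∀ i c, ((X.map fun x => x i) c).toReal =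
      ∑ x : X.support, if c = x.1 i then (X x).toReal else 0 := by
    intro i c
    have h0 : ∀ x ∉ hfin.toFinset, (if c = x i then X x else 0) = 0 := fun x hx => by
      rw [(X.apply_eq_zero_iff x).mpr fun h => hx (hfin.mem_toFinset.mpr h), ite_self]
    rw [PMF.map_apply, tsum_eq_sum h0,
      ENNReal.toReal_sum fun x _ => by split_ifs <;> simp [X.apply_ne_top],
      Finset.sum_subtype _ fun x => hfin.mem_toFinset]
    exact Finset.sum_congr rfl fun x _ => by split_ifs <;> simp
  have hcount : ∀ i j c, (∑ x : X.support, if c = x.1 i then m x else 0) =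
      ∑ x : X.support, if c = x.1 j then m x else 0 := by
    intro i j c
    -- Equality of marginals is a system of `ℚ`-linear equations in the weights, so `φ` preserves
    -- it.
    have h1 := congrArg φ (((hmap i c).symm.trans (by rw [hmarg i j])).trans (hmap j c))
    simp only [map_sum, apply_ite φ, map_zero] at h1
    have h2 := congrArg (D * ·) h1
    simp only [Finset.mul_sum, mul_ite, mul_zero, ← hm] at h2
    exact_mod_cast h2
  -- Take `m x` copies of each atom `x`. The coordinate functions then have equinumerous fibres,
  -- hence differ by permutations.
  let f : Fin r → (Σ x : X.support, Fin (m x)) → K := fun i s => s.1.1 i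
  have hcard : ∀ i c, Fintype.card {s // f i s = c} =
      ∑ x : X.support, if c = x.1 i then m x else 0 := by
    intro i c
    rw [Fintype.card_subtype, Finset.card_filter, Fintype.sum_sigma]
    refine Finset.sum_congr rfl fun x _ => ?_
    by_cases hc : x.1 i = c
    · simp [f, hc]
    · simp [f, hc, Ne.symm hc]
  have hequiv : ∀ i, ∃ e : Equiv.Perm (Σ x : X.support, Fin (m x)),
      ∀ s, f ⟨0, hr⟩ (e s) = f i s := by
    intro i
    have e : ∀ c, {s // f i s = c} ≃ {s // f ⟨0, hr⟩ s = c} := fun c =>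
      Fintype.equivOfCardEq (by rw [hcard, hcard, hcount])
    exact ⟨Equiv.ofFiberEquiv e, Equiv.ofFiberEquiv_map e⟩
  choose e he using hequiv
  refine .of_ker (L := K) e (f ⟨0, hr⟩) (fun h0 => hX0 ?_) fun s => ?_
  -- Each atom has at least one copy, so if one coordinate vanishes on all copies, every coordinate
  -- does.
  · have hz : ∀ x ∈ X.support, x = 0 := by
      intro x hx
      ext i
      have := he i ⟨⟨x, hx⟩, ⟨0, hm0 _⟩⟩
      rw [h0] at this
      exact this.symm
    ext x
    by_cases hx : x = 0
    · subst hx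
      have h1 := X.tsum_coe
      rw [tsum_eq_single 0 fun y hy => (X.apply_eq_zero_iff y).mpr fun h => hy (hz y h)] at h1
      simpa using h1
    · rw [(X.apply_eq_zero_iff x).mpr fun h => hx (hz x h)]
      simp [hx]
  · simp only [he]
    exact hsub s.1.2

/-! ### Group functions and normal bases -/

/-- A normal basis identifies `L` with the functions on the group, Galois action becoming left
translation; the conjugates are `σ i` of the element with coordinates `u`. -/
theorem IsGalois.exists_conjugates_sum_eq_zero {K L : Type*} [Field K] [Field L] [Algebra K L]
    [FiniteDimensional K L] [IsGalois K L] {r : ℕ} {a : Fin r → K} (σ : Fin r → Gal(L/K))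
    (u : Gal(L/K) → K) (hu : u ≠ 0) (h : ∀ g, ∑ i, a i * u ((σ i)⁻¹ * g) = 0) :
    ∃ θ : Fin r → L,
      (∀ i, θ i ≠ 0) ∧
      (∀ i j, ∃ τ : L ≃ₐ[K] L, τ (θ i) = θ j) ∧
      ∑ i, algebraMap K L (a i) * θ i = 0 := by
  let b := IsGalois.normalBasis K L
  have hθ : ∑ g, u g • b g ≠ 0 := fun h0 =>
    hu (funext (Fintype.linearIndependent_iff.mp b.linearIndependent u h0))
  refine ⟨fun i => σ i (∑ g, u g • b g), fun i => (map_ne_zero (σ i)).mpr hθ,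
    fun i j => ⟨σ j * (σ i)⁻¹, by simp [AlgEquiv.mul_apply, AlgEquiv.aut_inv]⟩, ?_⟩
  have h1 : ∀ i, σ i (∑ g, u g • b g) = ∑ g, u ((σ i)⁻¹ * g) • b g := by
    intro i
    rw [map_sum, ← Equiv.sum_comp (Equiv.mulLeft (σ i)) fun g => u ((σ i)⁻¹ * g) • b g]
    refine Finset.sum_congr rfl fun g _ => ?_
    simp only [b, Equiv.coe_mulLeft, inv_mul_cancel_left, map_smul]
    rw [IsGalois.normalBasis_apply g, IsGalois.normalBasis_apply (σ i * g)]
    rfl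
  simp only [h1, ← Algebra.smul_def, Finset.smul_sum, smul_smul]
  rw [Finset.sum_comm]
  simp only [← Finset.sum_smul, h, zero_smul, Finset.sum_const_zero]

/-! ### Symmetric Galois groups by reduction modulo two primes -/

open Polynomial

theorem FiniteField.exists_monic_irreducible_natDegree_eq (k : Type*) [Field k] [Finite k] {n : ℕ}
    (hn : n ≠ 0) : ∃ f : k[X], f.Monic ∧ Irreducible f ∧ f.natDegree = n := by
  obtain ⟨p, hp⟩ := CharP.exists k
  have : Fact p.Prime := ⟨CharP.char_is_prime k p⟩
  have : NeZero n := ⟨hn⟩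
  obtain ⟨x, hx⟩ := Field.exists_primitive_element k (FiniteField.Extension k p n)
  have hi : IsIntegral k x := .of_finite k x
  refine ⟨minpoly k x, minpoly.monic hi, minpoly.irreducible hi, ?_⟩
  exact ((Field.primitive_element_iff_minpoly_natDegree_eq k x).mp hx).trans
    (FiniteField.finrank_extension k p n)

theorem FiniteField.pow_card_pow_eq_self_iff {k κ : Type*} [Field k] [Finite k] [CommRing κ]
    [IsDomain κ] [Algebra k κ] {f : k[X]} (hf : Irreducible f) {x : κ} (hx : aeval x f = 0)
    (n : ℕ) : x ^ Nat.card k ^ n = x ↔ f.natDegree ∣ n := by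
  rw [hf.natDegree_dvd_iff_dvd_X_pow_card_pow_sub_X, ← hf.dvd_iff_aeval_eq_zero hx]
  simp [sub_eq_zero]

/-- A Frobenius permutation of the roots of a product of an irreducible quadratic and an irreducible
polynomial of odd degree `d` becomes a transposition when raised to the power `d`. -/
theorem FiniteField.isSwap_pow_of_frobenius {k κ Ω : Type*} [Field k] [Finite k] [CommRing κ]
    [IsDomain κ] [Algebra k κ] [Fintype Ω] [DecidableEq Ω] {σ : Equiv.Perm Ω} {ρ : Ω → κ}
    (hρ : Function.Injective ρ) (hσ : ∀ ω, ρ (σ ω) = ρ ω ^ Nat.card k) {g h : k[X]}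
    (hg : Irreducible g) (hh : Irreducible h) (hg2 : g.natDegree = 2) (hodd : Odd h.natDegree)
    (hroot : ∀ ω, aeval (ρ ω) (g * h) = 0) (hcard : Fintype.card Ω = 2 + h.natDegree) :
    (σ ^ h.natDegree).IsSwap := by
  classical
  have hpow : ∀ n ω, ρ ((σ ^ n) ω) = ρ ω ^ Nat.card k ^ n := by
    intro n
    induction n with
    | zero => simp
    | succ n ih =>
      intro ω
      rw [pow_succ', Equiv.Perm.mul_apply, hσ, ih, ← pow_mul, pow_succ]
  have hor : ∀ ω, aeval (ρ ω) g = 0 ∨ aeval (ρ ω) h = 0 := fun ω => by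
    simpa using hroot ω
  have hfix : ∀ ω, aeval (ρ ω) h = 0 → (σ ^ h.natDegree) ω = ω := fun ω hω =>
    hρ ((hpow _ ω).trans ((pow_card_pow_eq_self_iff hh hω _).mpr dvd_rfl))
  have hmove : ∀ ω, aeval (ρ ω) g = 0 → (σ ^ h.natDegree) ω ≠ ω := fun ω hω h0 => by
    have h1 := (pow_card_pow_eq_self_iff hg hω h.natDegree).mp (by rw [← hpow, h0])
    rw [hg2] at h1
    exact (Nat.not_even_iff_odd.mpr hodd) (even_iff_two_dvd.mpr h1)
  have hbound : ∀ (f : k[X]), f ≠ 0 → ∀ s : Finset Ω, (∀ ω ∈ s, aeval (ρ ω) f = 0) →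
      s.card ≤ f.natDegree := by
    intro f hf s hs
    rw [← Finset.card_image_of_injective s hρ]
    refine (Finset.card_le_card (t := (f.aroots κ).toFinset) ?_).trans
      ((Multiset.toFinset_card_le _).trans ((card_roots' _).trans natDegree_map_le))
    intro x hx
    obtain ⟨ω, hω, rfl⟩ := Finset.mem_image.mp hx
    rw [Multiset.mem_toFinset, mem_aroots]
    exact ⟨hf, hs ω hω⟩
  rw [← Equiv.Perm.card_support_eq_two]
  have hle : (σ ^ h.natDegree).support.card ≤ 2 := by
    rw [← hg2]
    refine hbound g hg.ne_zero _ fun ω hω => ?_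
    exact (hor ω).resolve_right fun h0 => Equiv.Perm.mem_support.mp hω (hfix ω h0)
  -- If nothing moved, all `2 + h.natDegree` points would map to roots of `h`.
  have hne : (σ ^ h.natDegree).support.card ≠ 0 := by
    intro h0
    rw [Finset.card_eq_zero] at h0
    have := hbound h hh.ne_zero Finset.univ fun ω _ => (hor ω).resolve_left fun h1 => by
      have := Equiv.Perm.mem_support.mpr (hmove ω h1)
      simp [h0] at this
    rw [Finset.card_univ, hcard] at this
    omega
  have := (σ ^ h.natDegree).card_support_ne_one
  omega

/-- Lifts of independent residues stay independent over `k`: a relation can be rescaled to have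
coefficients in `A`, not all in `p`, and then reduced. Finiteness of `B` over `A` is not needed, so
inseparable extensions are covered. -/
theorem Ideal.Quotient.finite_of_liesOver_of_finiteDimensional {A B : Type*} (k L : Type*)
    [CommRing A] [IsDedekindDomain A] [Field k] [Algebra A k] [IsFractionRing A k] [CommRing B]
    [Algebra A B] [Field L] [Algebra B L] [FaithfulSMul B L] [Algebra k L] [Algebra A L]
    [IsScalarTower A k L] [IsScalarTower A B L] [FiniteDimensional k L] (p : Ideal A)
    [p.IsMaximal] [Finite (A ⧸ p)] (Q : Ideal B) [Q.LiesOver p] : Finite (B ⧸ Q) := by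
  classical
  let := Ideal.Quotient.field p
  have hrank : Module.rank (A ⧸ p) (B ⧸ Q) ≤ Module.finrank k L := by
    refine rank_le fun s hs => ?_
    by_contra hlt
    choose lift hlift using Ideal.Quotient.mk_surjective (I := Q)
    have hdep : ¬ LinearIndependent k fun x : s => algebraMap B L (lift x) := fun hli => by
      have := hli.fintype_card_le_finrank
      simp at this
      omega
    rw [Fintype.not_linearIndependent_iff] at hdep
    obtain ⟨c, hc, j, hj⟩ := hdep
    obtain ⟨b, hint, i, -, hi⟩ := Ideal.exist_integer_multiples_notMem
      (‹p.IsMaximal›.ne_top) Finset.univ c (Finset.mem_univ j) hj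
    choose d hd using fun i => hint i (Finset.mem_univ i)
    have hsum : ∑ x : s, d x • lift x = 0 := by
      apply FaithfulSMul.algebraMap_injective B L
      rw [map_sum, map_zero]
      have : ∀ x : s, algebraMap B L (d x • lift x) = b • (c x • algebraMap B L (lift x)) := by
        intro x
        rw [smul_smul, ← hd, algebraMap_smul, Algebra.smul_def, map_mul,
          ← IsScalarTower.algebraMap_apply, ← Algebra.smul_def]
      simp only [this, ← Finset.smul_sum, hc, smul_zero]
    have hsum' : ∑ x : s, Ideal.Quotient.mk p (d x) • (x : B ⧸ Q) = 0 := by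
      have := congrArg (Ideal.Quotient.mk Q) hsum
      rw [map_sum, map_zero] at this
      rw [← this]
      refine Finset.sum_congr rfl fun x _ => ?_
      rw [Algebra.smul_def, Algebra.smul_def, map_mul, hlift]
      rfl
    have h0 := Fintype.linearIndependent_iff.mp hs _ hsum' i
    rw [Ideal.Quotient.eq_zero_iff_mem] at h0
    exact hi (by rw [← hd]; exact FractionalIdeal.mem_coeIdeal_of_mem _ h0)
  have : Module.Finite (A ⧸ p) (B ⧸ Q) :=
    Module.rank_lt_aleph0_iff.mp (hrank.trans_lt (Cardinal.natCast_lt_aleph0))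
  exact Module.finite_of_finite (A ⧸ p)

/-- Chinese remainder theorem on each coefficient below the leading one. -/
theorem Polynomial.exists_monic_map_eq_of_ne {R : Type*} [CommRing R] {P₁ P₂ : Ideal R}
    [h₁ : P₁.IsMaximal] [h₂ : P₂.IsMaximal] (hne : P₁ ≠ P₂) {f₁ : (R ⧸ P₁)[X]} {f₂ : (R ⧸ P₂)[X]}
    (hf₁ : f₁.Monic) (hf₂ : f₂.Monic) (hdeg : f₁.natDegree = f₂.natDegree) :
    ∃ f : R[X], f.Monic ∧ f.map (Ideal.Quotient.mk P₁) = f₁ ∧ f.map (Ideal.Quotient.mk P₂) = f₂ := by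
  have hc : ∀ n, ∃ c : R, Ideal.Quotient.mk P₁ c = f₁.coeff n ∧
      Ideal.Quotient.mk P₂ c = f₂.coeff n := by
    intro n
    obtain ⟨x, hx⟩ := (Ideal.quotientInfEquivQuotientProd P₁ P₂
      (Ideal.isCoprime_of_isMaximal hne)).surjective (f₁.coeff n, f₂.coeff n)
    obtain ⟨c, rfl⟩ := Ideal.Quotient.mk_surjective x
    exact ⟨c, congrArg Prod.fst hx, congrArg Prod.snd hx⟩
  choose c hc₁ hc₂ using hc
  refine ⟨X ^ f₁.natDegree + ∑ i ∈ Finset.range f₁.natDegree, C (c i) * X ^ i,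
    monic_X_pow_add ?_, ?_, ?_⟩
  · rw [← Fin.sum_univ_eq_sum_range fun i => C (c i) * X ^ i]
    exact degree_sum_fin_lt _
  · conv_rhs => rw [hf₁.as_sum]
    simp [Polynomial.map_sum, hc₁]
  · conv_rhs => rw [hf₂.as_sum]
    simp [Polynomial.map_sum, hc₂, hdeg]

/-- Distinct roots with equal reductions would give a double root of the reduced polynomial. -/
theorem Polynomial.Separable.eq_of_eval_eq_zero_of_map_eq {S κ : Type*} [CommRing S] [IsDomain S]
    [Field κ] (ρ : S →+* κ) {f : S[X]} (hsep : (f.map ρ).Separable) {x y : S}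
    (hx : f.eval x = 0) (hy : f.eval y = 0) (hxy : ρ x = ρ y) : x = y := by
  by_contra hne
  obtain ⟨q, rfl⟩ := dvd_iff_isRoot.mpr hx
  have hq : q.eval y = 0 := by
    rw [eval_mul, mul_eq_zero] at hy
    refine hy.resolve_left fun h0 => hne ?_
    simpa [sub_eq_zero, eq_comm] using h0
  have h1 : (q.map ρ).eval (ρ x) = 0 := by rw [hxy, eval_map_apply, hq, map_zero]
  obtain ⟨u, v, huv⟩ := hsep
  have := congrArg (eval (ρ x)) huv
  simp [derivative_mul, h1] at this

section

variable {R S K L : Type*} [CommRing R] [IsDomain R] [IsIntegrallyClosed R] [Field K]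
  [Algebra R K] [IsFractionRing R K] [Field L] [Algebra K L] [FiniteDimensional K L]
  [IsGalois K L] [Algebra R L] [IsScalarTower R K L] [CommRing S] [Algebra R S] [Algebra S L]
  [IsScalarTower R S L] [IsIntegralClosure S R L]

variable (K L) in
theorem exists_algEquiv_frobenius (P : Ideal R) (Q : Ideal S) [Q.IsPrime] [Q.LiesOver P]
    [Finite (S ⧸ Q)] : ∃ σ : Gal(L/K), ∀ x y : S, σ (algebraMap S L x) = algebraMap S L y →
      Ideal.Quotient.mk Q y = Ideal.Quotient.mk Q x ^ Nat.card (R ⧸ P) := by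
  let _ := IsIntegralClosure.MulSemiringAction R K L S
  have : IsDomain S := (IsIntegralClosure.algebraMap_injective S R L).isDomain
  have := IsIntegralClosure.isFractionRing_of_finite_extension R K L S
  have := Algebra.isInvariant_of_isGalois R K L S
  have : SMulCommClass Gal(L/K) R S := ⟨fun σ r s => map_smul (galRestrict R K L S σ) r s⟩
  obtain ⟨σ, hσ⟩ := IsArithFrobAt.exists_of_isInvariant R Gal(L/K) Q
  refine ⟨σ, fun x y hxy => ?_⟩
  have h1 := hσ.mk_apply x
  rw [← Ideal.over_def Q P] at h1
  rw [← h1]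
  congr 1
  apply IsIntegralClosure.algebraMap_injective S R L
  rw [← hxy]
  exact (algebraMap_galRestrict_apply R σ x).symm

/-- The roots are integral, so they lift to `S`; separability modulo `P` makes reduction modulo `Q`
injective on them, and Frobenius acts by the power map. -/
theorem exists_algEquiv_isSwap (P : Ideal R) [P.IsMaximal] [Finite (R ⧸ P)] (Q : Ideal S)
    [Q.IsPrime] [Q.LiesOver P] [Finite (S ⧸ Q)] {F : R[X]} (hF : F.Monic)
    (hsep : (F.map (algebraMap R K)).Separable)
    (hsplit : ((F.map (algebraMap R K)).map (algebraMap K L)).Splits)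
    (hsepP : (F.map (Ideal.Quotient.mk P)).Separable)
    [DecidableEq ((F.map (algebraMap R K)).rootSet L)] {g h : (R ⧸ P)[X]}
    (hg : Irreducible g) (hh : Irreducible h) (hg2 : g.natDegree = 2) (hodd : Odd h.natDegree) (hgh : F.map (Ideal.Quotient.mk P) = g * h) :
    ∃ τ : Gal(L/K), (MulAction.toPermHom Gal(L/K) ((F.map (algebraMap R K)).rootSet L) τ).IsSwap := by
  let _ := Ideal.Quotient.field P
  have hSL : Function.Injective (algebraMap S L) := IsIntegralClosure.algebraMap_injective S R L
  have : IsDomain S := hSL.isDomain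
  have hQm : Q.IsMaximal := Ideal.Quotient.maximal_of_isField _ (Finite.isField_of_domain (S ⧸ Q))
  let _ := Ideal.Quotient.field Q
  have hroot : ∀ ω : (F.map (algebraMap R K)).rootSet L, aeval (ω : L) F = 0 := fun ω => by
    rw [← aeval_map_algebraMap K]
    exact aeval_eq_zero_of_mem_rootSet ω.2
  have hlift : ∀ ω : (F.map (algebraMap R K)).rootSet L, ∃ s : S, algebraMap S L s = ω := fun ω =>
    IsIntegralClosure.isIntegral_iff.mp ⟨F, hF, by rw [← aeval_def, hroot]⟩
  choose s hs using hlift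
  have hs0 : ∀ ω, (F.map (algebraMap R S)).eval (s ω) = 0 := fun ω => hSL (by
    rw [map_zero, eval_map_algebraMap, ← aeval_algebraMap_apply, hs, hroot])
  have hmap : (F.map (algebraMap R S)).map (Ideal.Quotient.mk Q) =
      (F.map (Ideal.Quotient.mk P)).map (algebraMap (R ⧸ P) (S ⧸ Q)) := by
    rw [map_map, map_map]
    rfl
  obtain ⟨σ, hσ⟩ := exists_algEquiv_frobenius K L P Q
  have hcard : Fintype.card ((F.map (algebraMap R K)).rootSet L) = 2 + h.natDegree := by
    rw [card_rootSet_eq_natDegree hsep hsplit, hF.natDegree_map,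
      ← hF.natDegree_map (Ideal.Quotient.mk P), hgh, natDegree_mul hg.ne_zero hh.ne_zero, hg2]
  have key := FiniteField.isSwap_pow_of_frobenius (k := R ⧸ P) (κ := S ⧸ Q)
    (σ := MulAction.toPermHom Gal(L/K) ((F.map (algebraMap R K)).rootSet L) σ)
    (ρ := fun ω => Ideal.Quotient.mk Q (s ω)) (fun ω ω' h0 => ?_) (fun ω => ?_) hg hh hg2 hodd
    (fun ω => ?_) hcard
  · exact ⟨σ ^ h.natDegree, by rwa [map_pow]⟩
  · have := Separable.eq_of_eval_eq_zero_of_map_eq (Ideal.Quotient.mk Q) (f := F.map (algebraMap R S))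
      (by rw [hmap]; exact hsepP.map) (hs0 ω) (hs0 ω') h0
    exact Subtype.ext (by rw [← hs, ← hs, this])
  · exact hσ _ _ (by rw [hs, hs]; rfl)
  · rw [← hgh, ← eval_map_algebraMap, ← hmap, eval_map_apply, hs0, map_zero]

end

theorem Polynomial.toPermHom_rootSet_injective {K L : Type*} [Field K] [Field L] [Algebra K L]
    (f : K[X]) [f.IsSplittingField K L] :
    Function.Injective (MulAction.toPermHom Gal(L/K) (f.rootSet L)) := by
  intro σ τ h
  have : (σ : L →ₐ[K] L) = τ := AlgHom.ext_of_adjoin_eq_top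
    (IsSplittingField.adjoin_rootSet L f) fun x hx =>
      congrArg Subtype.val (Equiv.congr_fun h ⟨x, hx⟩)
  exact AlgEquiv.ext fun x => DFunLike.congr_fun this x

theorem Polynomial.natDegree_dvd_card_gal {K L : Type*} [Field K] [Field L] [Algebra K L]
    [FiniteDimensional K L] [IsGalois K L] {f : K[X]} (hf : Irreducible f)
    (hsplit : (f.map (algebraMap K L)).Splits) : f.natDegree ∣ Nat.card Gal(L/K) := by
  rw [IsGalois.card_aut_eq_finrank]
  exact hf.natDegree_dvd_finrank hsplit

theorem IsDedekindDomain.exists_galois_surjective_perm {A : Type*} (k : Type*) {K : Type*}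
    [CommRing A] [IsDedekindDomain A] [Field k] [Algebra A k] [IsFractionRing A k] [Field K] [Algebra k K]
    [Algebra A K] [IsScalarTower A k K] [FiniteDimensional k K] {p₁ p₂ : Ideal A}
    [p₁.IsMaximal] [p₂.IsMaximal] (hne : p₁ ≠ p₂) [Finite (A ⧸ p₁)] [Finite (A ⧸ p₂)] {ℓ : ℕ}
    (hℓ : ℓ.Prime) (hodd : Odd ℓ) :
    ∃ f : K[X], ∃ _ : IsGalois K f.SplittingField, Fintype.card (f.rootSet f.SplittingField) = ℓ ∧
      Function.Surjective
        (MulAction.toPermHom Gal(f.SplittingField/K) (f.rootSet f.SplittingField)) := by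
  classical
  let R := integralClosure A K
  have : IsFractionRing R K := integralClosure.isFractionRing_of_finite_extension k K
  have : IsIntegrallyClosed R := integralClosure.isIntegrallyClosedOfFiniteExtension k
  have : FaithfulSMul A K := by
    rw [faithfulSMul_iff_algebraMap_injective, IsScalarTower.algebraMap_eq A k K]
    exact (algebraMap k K).injective.comp (IsFractionRing.injective A k)
  obtain ⟨P₁, _, _⟩ := Ideal.exists_maximal_ideal_liesOver_of_isIntegral (S := R) p₁
  obtain ⟨P₂, _, _⟩ := Ideal.exists_maximal_ideal_liesOver_of_isIntegral (S := R) p₂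
  have hP : P₁ ≠ P₂ := by
    rintro rfl
    exact hne ((Ideal.over_def P₁ p₁).trans (Ideal.over_def P₁ p₂).symm)
  have := Ideal.Quotient.finite_of_liesOver_of_finiteDimensional k K p₁ P₁
  have := Ideal.Quotient.finite_of_liesOver_of_finiteDimensional k K p₂ P₂
  let _ := Ideal.Quotient.field P₁
  let _ := Ideal.Quotient.field P₂
  have hℓ3 : 3 ≤ ℓ := by
    have := hℓ.two_le
    obtain ⟨m, rfl⟩ := hodd
    omega
  obtain ⟨f₁, hf₁m, hf₁, hf₁d⟩ :=
    FiniteField.exists_monic_irreducible_natDegree_eq (R ⧸ P₁) hℓ.ne_zero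
  obtain ⟨g, hgm, hg, hgd⟩ :=
    FiniteField.exists_monic_irreducible_natDegree_eq (R ⧸ P₂) two_ne_zero
  obtain ⟨h, hhm, hh, hhd⟩ :=
    FiniteField.exists_monic_irreducible_natDegree_eq (R ⧸ P₂) (n := ℓ - 2) (by omega)
  have hhodd : Odd h.natDegree := by
    rw [hhd]
    exact Nat.Odd.sub_even (by omega) hodd even_two
  obtain ⟨F, hFm, hF₁, hF₂⟩ := exists_monic_map_eq_of_ne hP hf₁m (hgm.mul hhm)
    (by rw [hf₁d, hgm.natDegree_mul hhm, hgd, hhd]; omega)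
  have hsepP : (F.map (Ideal.Quotient.mk P₂)).Separable := by
    rw [hF₂]
    refine (PerfectField.separable_of_irreducible hg).mul
      (PerfectField.separable_of_irreducible hh) ((hg.coprime_iff_not_dvd).mpr fun hdvd => ?_)
    have h1 := natDegree_eq_of_degree_eq (degree_eq_degree_of_associated
      (hg.associated_of_dvd hh hdvd))
    rw [← h1, hgd] at hhodd
    exact absurd hhodd (by decide)
  -- Gauss's lemma, over the integrally closed `R`.
  have hirr : Irreducible (F.map (algebraMap R K)) :=
    (hFm.irreducible_iff_irreducible_map_fraction_map).mp
      (hFm.irreducible_of_irreducible_map (Ideal.Quotient.mk P₁) F (by rwa [hF₁]))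
  -- In positive characteristic irreducibility is not enough; a zero derivative would contradict
  -- separability modulo `P₂`.
  have hsep : (F.map (algebraMap R K)).Separable := by
    rw [separable_iff_derivative_ne_zero hirr, derivative_map]
    intro h0
    rw [Polynomial.map_eq_zero_iff (IsFractionRing.injective R K)] at h0
    have h1 := hsepP
    rw [separable_def, derivative_map, h0, Polynomial.map_zero, isCoprime_zero_right, hF₂] at h1
    exact hg.not_isUnit (isUnit_of_mul_isUnit_left h1)
  have hdeg : (F.map (algebraMap R K)).natDegree = ℓ := by
    rw [hFm.natDegree_map, ← hFm.natDegree_map (Ideal.Quotient.mk P₁), hF₁, hf₁d]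
  let L := (F.map (algebraMap R K)).SplittingField
  have hsplit := SplittingField.splits (F.map (algebraMap R K))
  have hgal : IsGalois K L := IsGalois.of_separable_splitting_field hsep
  have hcard : Fintype.card ((F.map (algebraMap R K)).rootSet L) = ℓ := by
    rw [card_rootSet_eq_natDegree hsep hsplit, hdeg]
  refine ⟨F.map (algebraMap R K), hgal, hcard, ?_⟩
  let S := integralClosure R L
  have : FaithfulSMul R L := by
    rw [faithfulSMul_iff_algebraMap_injective, IsScalarTower.algebraMap_eq R K L]
    exact (algebraMap K L).injective.comp (IsFractionRing.injective R K)
  have : FaithfulSMul R S := (faithfulSMul_iff_algebraMap_injective R S).mpr fun x y h =>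
    FaithfulSMul.algebraMap_injective R L (congrArg (algebraMap S L) h)
  obtain ⟨Q, _, _⟩ := Ideal.exists_maximal_ideal_liesOver_of_isIntegral (S := S) P₂
  have : FiniteDimensional k L := Module.Finite.trans K L
  have : IsScalarTower A k L := .of_algebraMap_eq fun x => by
    rw [IsScalarTower.algebraMap_apply A K L, IsScalarTower.algebraMap_apply k K L,
      ← IsScalarTower.algebraMap_apply A k K]
  have : Q.LiesOver p₂ := Ideal.LiesOver.trans Q P₂ p₂
  have := Ideal.Quotient.finite_of_liesOver_of_finiteDimensional k L p₂ Q
  obtain ⟨τ, hτ⟩ := exists_algEquiv_isSwap (L := L) P₂ Q hFm hsep hsplit hsepP hg hh hgd hhodd hF₂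
  rw [← MonoidHom.range_eq_top]
  -- A subgroup of `S_ℓ` of order divisible by the prime `ℓ` and containing a transposition is
  -- everything.
  refine Equiv.Perm.subgroup_eq_top_of_swap_mem (by rwa [hcard]) ?_ ⟨τ, rfl⟩ hτ
  rw [hcard, Fintype.card_eq_nat_card, ← Nat.card_congr (MonoidHom.ofInjective
    (toPermHom_rootSet_injective (L := L) (F.map (algebraMap R K)))).toEquiv]
  exact hdeg ▸ natDegree_dvd_card_gal hirr hsplit

/-- Every global field has, for each odd prime `ℓ`, a Galois extension that is the splitting field
of a polynomial with `ℓ` roots, on which the Galois group acts as the full symmetric group. -/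
theorem IsGlobalField.exists_galois_surjective_perm {K : Type*} [Field K] (hK : IsGlobalField K)
    {ℓ : ℕ} (hℓ : ℓ.Prime) (hodd : Odd ℓ) :
    ∃ f : K[X], ∃ _ : IsGalois K f.SplittingField, Fintype.card (f.rootSet f.SplittingField) = ℓ ∧
      Function.Surjective
        (MulAction.toPermHom Gal(f.SplittingField/K) (f.rootSet f.SplittingField)) := by
  rcases hK with hK | ⟨F, _, _, _, hK⟩
  · have hmax : ∀ p : ℕ, p.Prime → (Ideal.span {(p : ℤ)}).IsMaximal := fun p hp =>
      PrincipalIdealRing.isMaximal_of_irreducible (Nat.prime_iff_prime_int.mp hp).irreducible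
    have hfin : ∀ p : ℕ, p.Prime → Finite (ℤ ⧸ Ideal.span {(p : ℤ)}) := fun p hp =>
      have : NeZero p := ⟨hp.ne_zero⟩
      .of_equiv _ (Int.quotientSpanNatEquivZMod p).symm.toEquiv
    have := hmax 2 Nat.prime_two
    have := hmax 3 Nat.prime_three
    have := hfin 2 Nat.prime_two
    have := hfin 3 Nat.prime_three
    refine IsDedekindDomain.exists_galois_surjective_perm (A := ℤ) ℚ (p₁ := Ideal.span {((2 : ℕ) : ℤ)})
      (p₂ := Ideal.span {((3 : ℕ) : ℤ)}) (fun h => ?_) hℓ hodd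
    have h1 := Ideal.mem_span_singleton_self ((2 : ℕ) : ℤ)
    rw [h, Ideal.mem_span_singleton] at h1
    revert h1
    decide
  · let _ : Algebra F[X] K :=
      ((algebraMap (RatFunc F) K).comp (algebraMap F[X] (RatFunc F))).toAlgebra
    have : IsScalarTower F[X] (RatFunc F) K := .of_algebraMap_eq fun _ => rfl
    have hmax : ∀ c : F, (Ideal.span {X - C c}).IsMaximal := fun c =>
      PrincipalIdealRing.isMaximal_of_irreducible (irreducible_X_sub_C c)
    have hfin : ∀ c : F, Finite (F[X] ⧸ Ideal.span {X - C c}) := fun c =>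
      .of_equiv _ (quotientSpanXSubCAlgEquiv c).symm.toEquiv
    have := hmax 0
    have := hmax 1
    have := hfin 0
    have := hfin 1
    refine IsDedekindDomain.exists_galois_surjective_perm (A := F[X]) (RatFunc F)
      (p₁ := Ideal.span {X - C 0}) (p₂ := Ideal.span {X - C 1}) (fun h => ?_) hℓ hodd
    have h1 := Ideal.mem_span_singleton_self (X - C (0 : F))
    rw [h, Ideal.mem_span_singleton, dvd_iff_isRoot] at h1
    simp at h1

/-! ### Realising the permutations by Galois automorphisms -/

theorem HasSingularPermutationCombination.hasGaloisConjugateRelation {K : Type*} [Field K]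
    (hK : IsGlobalField K) {r : ℕ} {a : Fin r → K} (h : HasSingularPermutationCombination a) :
    HasGaloisConjugateRelation a := by
  classical
  obtain ⟨N, P, v, hv, h⟩ := h.exists_ker
  obtain ⟨n₀, hn₀⟩ := Function.ne_iff.mp hv
  obtain ⟨ℓ, hNℓ, hℓ⟩ := Nat.exists_infinite_primes (max N 3)
  obtain ⟨f, hgal, hcard, hsurj⟩ := hK.exists_galois_surjective_perm hℓ
    (hℓ.odd_of_ne_two (by omega))
  obtain ⟨ι⟩ : Nonempty (Fin N ↪ f.rootSet f.SplittingField) :=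
    Function.Embedding.nonempty_of_card_le (by rw [hcard, Fintype.card_fin]; omega)
  choose σ hσ using fun i => hsurj ((P i).viaEmbedding ι)
  -- The extended permutations fix every point outside the range of `ι`, so extending `v` by zero
  -- keeps the kernel equations.
  let w : f.rootSet f.SplittingField → K := Function.extend ι v 0
  have hw0 : ∀ x ∉ Set.range ι, w x = 0 := fun x hx => Function.extend_apply' v _ x hx
  have hw : ∀ x, ∑ i, a i * w ((P i).viaEmbedding ι x) = 0 := by
    intro x
    by_cases hx : x ∈ Set.range ι
    · obtain ⟨n, rfl⟩ := hx
      simpa [w, Equiv.Perm.viaEmbedding_apply, ι.injective.extend_apply] using h n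
    · refine Finset.sum_eq_zero fun i _ => ?_
      rw [Equiv.Perm.viaEmbedding_apply_of_notMem _ _ _ hx]
      rw [hw0 x hx, mul_zero]
  -- Pull `w` back along the orbit map of `ι n₀`; its value at `1` is `v n₀ ≠ 0`.
  refine ⟨f.SplittingField, inferInstance, inferInstance, inferInstance, hgal,
    IsGalois.exists_conjugates_sum_eq_zero (fun i => (σ i)⁻¹) (fun g => w (g • ι n₀)) (fun h0 => hn₀ ?_)
      fun g => ?_⟩
  · have := congrFun h0 1
    simpa [w, ι.injective.extend_apply] using this
  · have := hw (g • ι n₀)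
    simp only [← hσ, MulAction.toPermHom_apply, MulAction.toPerm_apply] at this
    simpa only [inv_inv, mul_smul] using this

theorem mainTheorem3 {K : Type*} [Field K] (hK : IsGlobalField K) (r : ℕ) (hr : 1 ≤ r)
    (a : Fin r → K) :
    List.TFAE [HasGaloisConjugateRelation a, HasBalancedDistribution a,
      HasSingularPermutationCombination a] := by
  tfae_have 1 → 3 := fun h => h.hasSingularPermutationCombination hr
  tfae_have 3 → 2 := fun h => h.hasBalancedDistribution hr
  tfae_have 2 → 3 := fun h => h.hasSingularPermutationCombination hr
  tfae_have 3 → 1 := fun h => h.hasGaloisConjugateRelation hK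
  tfae_finish
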